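/- A closed continuous 2-frieze of period $T>0$ is a pair of smooth functions $F,G:\mathbb R^2\to\mathbb R$ such that $G=FF_{xy}-F_xF_y$ and $F=GG_{xy}-G_xG_y$, and such that for all $x,y$ $$F(x,x)=F_x(x,x)=F_y(x,x)=0,\quad F_{xx}(x,x)=F_{yy}(x,x)=1,\quad F_{xy}(x,x)=-1,\quad F(x+T,y)=F(x,y+T)=F(x,y),$$ and likewise for $G$. A closed projective curve of period $T$ is a smooth map $\gamma:\mathbb R\to\mathbb{RP}^2$ with $\gamma(x+T)=\gamma(x)$ that is locally convex, that is, $\det(c,c',c'')\neq 0$ for every smooth local lift $c$ of $\gamma$ to $\mathbb R^3\setminus\{0\}$. Let $\Gamma:\mathbb R\to\mathbb R^3$ be the smooth lift of $\gamma$ normalized by $\det(\Gamma,\Gamma',\Gamma'')=1$. The curve $\gamma$ corresponds to $(F,G)$ if $F(x,y)=\Gamma(x)\cdot(\Gamma(y)\times\Gamma'(y))$ for all $x,y$. Let $(F,G)$ be a closed continuous 2-frieze of period $T>0$. Then there is a closed projective curve of period $T$ that corresponds to $(F,G)$, and for every such curve $\gamma$ one has $F(x,y)=G(x,y)$ for all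 $x,y\in\mathbb R$ if and only if $\gamma$ is a conic, that is, if and only if the image of $\gamma$ is a nondegenerate conic in $\mathbb{RP}^2$. -/

import Mathlib

open scoped ContDiff Topology Matrix

noncomputable section

namespace TwoFrieze

/-! Functions of two real variables and their partial derivatives -/

/-- The partial derivative with respect to the first variable. -/
def dx (F : ℝ → ℝ → ℝ) : ℝ → ℝ → ℝ := fun x y => deriv (fun t => F t y) x

/-- The partial derivative with respect to the second variable. -/
def dy (F : ℝ → ℝ → ℝ) : ℝ → ℝ → ℝ := fun x y => deriv (fun t => F x t) y

/-- `F` is a smooth function of two variables. -/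
def Smooth₂ (F : ℝ → ℝ → ℝ) : Prop := ContDiff ℝ ∞ (fun p : ℝ × ℝ => F p.1 p.2)

/-- A continuous 2-frieze: smooth `F`, `G` with
`G = F F_xy - F_x F_y` and `F = G G_xy - G_x G_y`. -/
structure IsTwoFrieze (F G : ℝ → ℝ → ℝ) : Prop where
  smooth_left : Smooth₂ F
  smooth_right : Smooth₂ G
  right_eq : ∀ x y, G x y = F x y * dy (dx F) x y - dx F x y * dy F x y
  left_eq : ∀ x y, F x y = G x y * dy (dx G) x y - dx G x y * dy G x y

/-- The boundary and periodicity conditions, with period `T`, for one function. -/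
structure BoundaryConditions (T : ℝ) (F : ℝ → ℝ → ℝ) : Prop where
  diag : ∀ x, F x x = 0
  diag_x : ∀ x, dx F x x = 0
  diag_y : ∀ x, dy F x x = 0
  diag_xx : ∀ x, dx (dx F) x x = 1
  diag_yy : ∀ x, dy (dy F) x x = 1
  diag_xy : ∀ x, dy (dx F) x x = -1
  periodic_x : ∀ x y, F (x + T) y = F x y
  periodic_y : ∀ x y, F x (y + T) = F x y

/-- A closed continuous 2-frieze of period `T` (positivity is not required). -/
structure IsClosedTwoFrieze (T : ℝ) (F G : ℝ → ℝ → ℝ) : Prop where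
  frieze : IsTwoFrieze F G
  boundary_left : BoundaryConditions T F
  boundary_right : BoundaryConditions T G

/-! Projective curves -/

/-- The real projective plane. -/
abbrev RP2 : Type := Projectivization ℝ (Fin 3 → ℝ)

/-- The determinant `det (c, c', c'')` of a curve in `ℝ³`. -/
def wronskian (c : ℝ → Fin 3 → ℝ) (x : ℝ) : ℝ :=
  Matrix.det (Matrix.of ![c x, deriv c x, deriv (deriv c) x])

/-- The vector `v` is nonzero and is a vector of homogeneous coordinates of the point `p`. -/
def Represents (v : Fin 3 → ℝ) (p : RP2) : Prop :=
  ∃ h : v ≠ 0, Projectivization.mk ℝ v h = p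

/-- A projective curve: a smooth, locally convex parameterized curve in the projective plane.
Near every parameter value it has smooth homogeneous coordinates `c`, and it has no inflection
points: `det (c, c', c'') ≠ 0` (a condition that does not depend on the choice of `c`). -/
def IsProjectiveCurve (γ : ℝ → RP2) : Prop :=
  ∀ x₀ : ℝ, ∃ c : ℝ → Fin 3 → ℝ, ContDiffAt ℝ ∞ c x₀ ∧
    (∀ᶠ x in 𝓝 x₀, Represents (c x) (γ x)) ∧ wronskian c x₀ ≠ 0

/-- A closed projective curve of period `T`. -/
structure IsClosedProjectiveCurve (T : ℝ) (γ : ℝ → RP2) : Prop where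
  curve : IsProjectiveCurve γ
  periodic : ∀ x, γ (x + T) = γ x

/-- `Γ` is the lift of `γ` to `ℝ³` normalized by `det (Γ, Γ', Γ'') = 1`. -/
structure IsLift (Γ : ℝ → Fin 3 → ℝ) (γ : ℝ → RP2) : Prop where
  smooth : ContDiff ℝ ∞ Γ
  represents : ∀ x, Represents (Γ x) (γ x)
  normalized : ∀ x, wronskian Γ x = 1

/-- The lift `Γ* = Γ × Γ'` of the dual curve, which consists of the tangent lines;
covectors are identified with vectors by means of the dot product. -/
def dualLift (Γ : ℝ → Fin 3 → ℝ) : ℝ → Fin 3 → ℝ := fun y => crossProduct (Γ y) (deriv Γ y)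

/-- The projective curve `γ` corresponds to the 2-frieze whose first function is `F`:
`F(x,y) = Γ(x) · Γ*(y)`, where `Γ` is the normalized lift of `γ`. The second function of a
2-frieze is determined by the first one. -/
def Corresponds (γ : ℝ → RP2) (F : ℝ → ℝ → ℝ) : Prop :=
  ∃ Γ : ℝ → Fin 3 → ℝ, IsLift Γ γ ∧ ∀ x y, F x y = Γ x ⬝ᵥ dualLift Γ y

/-- The conic in the projective plane with the equation `vᵀ Q v = 0`. -/
def conic (Q : Matrix (Fin 3) (Fin 3) ℝ) : Set RP2 :=
  {p | ∀ v ∈ p.submodule, v ⬝ᵥ (Q *ᵥ v) = 0}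

/-- The curve `γ` is a conic: its trace is a nondegenerate conic. -/
def IsConic (γ : ℝ → RP2) : Prop :=
  ∃ Q : Matrix (Fin 3) (Fin 3) ℝ, Q.IsSymm ∧ Q.det ≠ 0 ∧ Set.range γ = conic Q

end TwoFrieze

end

namespace TwoFrieze

/-! ### Calculus of smooth functions of two variables -/

/-! Let M be the determinant of the matrix of partials of F of orders 0, 1, 2 in each variable. By
Desnanot–Jacobi the two frieze equations give F·M = F. Where M ≠ 1, F vanishes locally, so M = 0; as
M is continuous and equals 1 on the diagonal, M = 1 everywhere (`IsTwoFrieze.minor_eq_one`).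
Differentiating M = 1 shows that F(·, y) and its first two y-derivatives solve u''' = a u + b u',
and a, b do not depend on y (`IsTwoFrieze.dy_minors`). So (F, F_y, F_yy)(·, 0) is a normalized curve
Γ, and comparison of initial values at x = y gives F(x, y) = Γ(x) · Γ*(y) with Γ* = Γ × Γ'
(`IsClosedTwoFrieze.eq_dotProduct`).

For every corresponding curve G(x, y) = F(y, x) (`IsTwoFrieze.right_eq_left_swap`), so F = G means
that the pairing Γ(x) · Γ*(y) is symmetric. Symmetry yields a polarity Γ* = QΓ (`exists_polarity`);
then Γ · QΓ = 0 puts γ on a conic, and a Rolle argument with periodicity shows that γ covers it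
(`range_eq_conic`). Conversely, on a conic QΓ = λΓ* with λ³ = det Q, so λ is constant and the
symmetry of Q passes to the pairing (`dotProduct_dualLift_comm`). -/

theorem Smooth₂.hasDerivAt_left {F : ℝ → ℝ → ℝ} (h : Smooth₂ F) (x y : ℝ) :
    HasDerivAt (fun t => F t y) (dx F x y) x := by
  have h1 : Differentiable ℝ (fun p : ℝ × ℝ => F p.1 p.2) := h.differentiable (by simp)
  have h2 : Differentiable ℝ (fun t : ℝ => F t y) :=
    h1.comp (f := fun t : ℝ => (t, y)) (by fun_prop)
  exact (h2 x).hasDerivAt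

theorem Smooth₂.hasDerivAt_right {F : ℝ → ℝ → ℝ} (h : Smooth₂ F) (x y : ℝ) :
    HasDerivAt (fun t => F x t) (dy F x y) y := by
  have h1 : Differentiable ℝ (fun p : ℝ × ℝ => F p.1 p.2) := h.differentiable (by simp)
  have h2 : Differentiable ℝ (fun t : ℝ => F x t) :=
    h1.comp (f := fun t : ℝ => (x, t)) (by fun_prop)
  exact (h2 y).hasDerivAt

theorem Smooth₂.dx_eq_fderiv {F : ℝ → ℝ → ℝ} (h : Smooth₂ F) (p : ℝ × ℝ) :
    dx F p.1 p.2 = fderiv ℝ (fun p : ℝ × ℝ => F p.1 p.2) p (1, 0) := by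
  have h1 : Differentiable ℝ (fun p : ℝ × ℝ => F p.1 p.2) := h.differentiable (by simp)
  have h2 : HasDerivAt (fun t : ℝ => (t, p.2)) ((1 : ℝ), (0 : ℝ)) p.1 :=
    (hasDerivAt_id p.1).prodMk (hasDerivAt_const _ _)
  exact (HasFDerivAt.comp_hasDerivAt p.1 (h1 (p.1, p.2)).hasFDerivAt h2).deriv

theorem Smooth₂.dy_eq_fderiv {F : ℝ → ℝ → ℝ} (h : Smooth₂ F) (p : ℝ × ℝ) :
    dy F p.1 p.2 = fderiv ℝ (fun p : ℝ × ℝ => F p.1 p.2) p (0, 1) := by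
  have h1 : Differentiable ℝ (fun p : ℝ × ℝ => F p.1 p.2) := h.differentiable (by simp)
  have h2 : HasDerivAt (fun t : ℝ => (p.1, t)) ((0 : ℝ), (1 : ℝ)) p.2 :=
    (hasDerivAt_const _ _).prodMk (hasDerivAt_id p.2)
  exact (HasFDerivAt.comp_hasDerivAt p.2 (h1 (p.1, p.2)).hasFDerivAt h2).deriv

theorem Smooth₂.dx {F : ℝ → ℝ → ℝ} (h : Smooth₂ F) : Smooth₂ (dx F) := by
  have h1 : ContDiff ℝ ∞ (fderiv ℝ (fun p : ℝ × ℝ => F p.1 p.2)) :=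
    ContDiff.fderiv_right h (by simp)
  have h2 : (fun p : ℝ × ℝ => TwoFrieze.dx F p.1 p.2) =
      fun p => fderiv ℝ (fun p : ℝ × ℝ => F p.1 p.2) p (1, 0) :=
    funext h.dx_eq_fderiv
  unfold Smooth₂
  rw [h2]
  exact h1.clm_apply contDiff_const

theorem Smooth₂.dy {F : ℝ → ℝ → ℝ} (h : Smooth₂ F) : Smooth₂ (dy F) := by
  have h1 : ContDiff ℝ ∞ (fderiv ℝ (fun p : ℝ × ℝ => F p.1 p.2)) :=
    ContDiff.fderiv_right h (by simp)
  have h2 : (fun p : ℝ × ℝ => TwoFrieze.dy F p.1 p.2) =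
      fun p => fderiv ℝ (fun p : ℝ × ℝ => F p.1 p.2) p (0, 1) :=
    funext h.dy_eq_fderiv
  unfold Smooth₂
  rw [h2]
  exact h1.clm_apply contDiff_const

theorem Smooth₂.dy_dx {F : ℝ → ℝ → ℝ} (h : Smooth₂ F) :
    TwoFrieze.dy (TwoFrieze.dx F) = TwoFrieze.dx (TwoFrieze.dy F) := by
  have h1 : Differentiable ℝ (fderiv ℝ (fun p : ℝ × ℝ => F p.1 p.2)) :=
    (ContDiff.fderiv_right (m := ∞) h (by simp)).differentiable (by simp)
  have key : ∀ (p u v : ℝ × ℝ),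
      fderiv ℝ (fun q => fderiv ℝ (fun p : ℝ × ℝ => F p.1 p.2) q u) p v =
        fderiv ℝ (fderiv ℝ (fun p : ℝ × ℝ => F p.1 p.2)) p v u := by
    intro p u v
    rw [fderiv_clm_apply (h1 p) (differentiableAt_const u)]
    simp
  have hs : ∀ p : ℝ × ℝ, IsSymmSndFDerivAt ℝ (fun p : ℝ × ℝ => F p.1 p.2) p := fun p =>
    (ContDiff.contDiffAt h).isSymmSndFDerivAt (by simpa using WithTop.coe_le_coe.2 (le_top : (2 : ℕ∞) ≤ ⊤))
  funext x y
  have e1 := h.dx.dy_eq_fderiv (x, y)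
  have e2 := h.dy.dx_eq_fderiv (x, y)
  rw [funext h.dx_eq_fderiv, key] at e1
  rw [funext h.dy_eq_fderiv, key] at e2
  exact e1.trans ((hs (x, y) _ _).trans e2.symm)

/-- The mixed partial derivative of order `i` in the first and `j` in the second variable. -/
noncomputable def partials (F : ℝ → ℝ → ℝ) (i j : ℕ) : ℝ → ℝ → ℝ := dx^[i] (dy^[j] F)

theorem Smooth₂.partials {F : ℝ → ℝ → ℝ} (h : Smooth₂ F) (i j : ℕ) :
    Smooth₂ (partials F i j) := by
  have hj : Smooth₂ (TwoFrieze.dy^[j] F) := by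
    induction j with
    | zero => exact h
    | succ j ih => rw [Function.iterate_succ_apply']; exact ih.dy
  unfold TwoFrieze.partials
  induction i with
  | zero => exact hj
  | succ i ih => rw [Function.iterate_succ_apply']; exact ih.dx

theorem dx_partials (F : ℝ → ℝ → ℝ) (i j : ℕ) : dx (partials F i j) = partials F (i + 1) j :=
  (Function.iterate_succ_apply' dx i _).symm

theorem Smooth₂.dy_partials {F : ℝ → ℝ → ℝ} (h : Smooth₂ F) (i j : ℕ) :
    TwoFrieze.dy (TwoFrieze.partials F i j) = TwoFrieze.partials F i (j + 1) := by
  induction i with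
  | zero => exact (Function.iterate_succ_apply' TwoFrieze.dy j F).symm
  | succ i ih => rw [← dx_partials, (h.partials i j).dy_dx, ih, dx_partials]

theorem Smooth₂.hasDerivAt_partials_left {F : ℝ → ℝ → ℝ} (h : Smooth₂ F) (i j : ℕ) (x y : ℝ) :
    HasDerivAt (fun t => TwoFrieze.partials F i j t y) (TwoFrieze.partials F (i + 1) j x y) x := by
  rw [← dx_partials]
  exact (h.partials i j).hasDerivAt_left x y

theorem Smooth₂.hasDerivAt_partials_right {F : ℝ → ℝ → ℝ} (h : Smooth₂ F) (i j : ℕ) (x y : ℝ) :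
    HasDerivAt (fun t => TwoFrieze.partials F i j x t) (TwoFrieze.partials F i (j + 1) x y) y := by
  rw [← h.dy_partials]
  exact (h.partials i j).hasDerivAt_right x y

theorem eventually_dx_eq_zero {F : ℝ → ℝ → ℝ} {p : ℝ × ℝ}
    (h : ∀ᶠ q in 𝓝 p, F q.1 q.2 = 0) : ∀ᶠ q in 𝓝 p, dx F q.1 q.2 = 0 := by
  filter_upwards [h.eventually_nhds] with q hq
  have hc : Filter.Tendsto (fun t : ℝ => (t, q.2)) (𝓝 q.1) (𝓝 q) := by
    have : Continuous (fun t : ℝ => (t, q.2)) := by fun_prop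
    exact this.tendsto q.1
  have h0 : (fun t => F t q.2) =ᶠ[𝓝 q.1] fun _ => (0 : ℝ) := hc.eventually hq
  exact h0.deriv_eq.trans (deriv_const _ _)

theorem eventually_dy_eq_zero {F : ℝ → ℝ → ℝ} {p : ℝ × ℝ}
    (h : ∀ᶠ q in 𝓝 p, F q.1 q.2 = 0) : ∀ᶠ q in 𝓝 p, dy F q.1 q.2 = 0 := by
  filter_upwards [h.eventually_nhds] with q hq
  have hc : Filter.Tendsto (fun t : ℝ => (q.1, t)) (𝓝 q.2) (𝓝 q) := by
    have : Continuous (fun t : ℝ => (q.1, t)) := by fun_prop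
    exact this.tendsto q.2
  have h0 : (fun t => F q.1 t) =ᶠ[𝓝 q.2] fun _ => (0 : ℝ) := hc.eventually hq
  exact h0.deriv_eq.trans (deriv_const _ _)

theorem eventually_partials_eq_zero {F : ℝ → ℝ → ℝ} {p : ℝ × ℝ}
    (h : ∀ᶠ q in 𝓝 p, F q.1 q.2 = 0) (i j : ℕ) :
    ∀ᶠ q in 𝓝 p, partials F i j q.1 q.2 = 0 := by
  have hj : ∀ᶠ q in 𝓝 p, (dy^[j] F) q.1 q.2 = 0 := by
    induction j with
    | zero => exact h
    | succ j ih => rw [Function.iterate_succ_apply']; exact eventually_dy_eq_zero ih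
  unfold partials
  induction i with
  | zero => exact hj
  | succ i ih => rw [Function.iterate_succ_apply']; exact eventually_dx_eq_zero ih

/-! ### Linear differential equations of third order -/

/-- `u` solves `u''' = a u + b u'`, where `u₁ = u'` and `u₂ = u''`. -/
structure SolvesThirdOrder (a b u u₁ u₂ : ℝ → ℝ) : Prop where
  deriv₀ : ∀ x, HasDerivAt u (u₁ x) x
  deriv₁ : ∀ x, HasDerivAt u₁ (u₂ x) x
  deriv₂ : ∀ x, HasDerivAt u₂ (a x * u x + b x * u₁ x) x

theorem SolvesThirdOrder.smul {a b u u₁ u₂ : ℝ → ℝ} (hu : SolvesThirdOrder a b u u₁ u₂) (c : ℝ) :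
    SolvesThirdOrder a b (fun x => c * u x) (fun x => c * u₁ x) (fun x => c * u₂ x) where
  deriv₀ x := (hu.deriv₀ x).const_mul c
  deriv₁ x := (hu.deriv₁ x).const_mul c
  deriv₂ x := ((hu.deriv₂ x).const_mul c).congr_deriv (by ring)

theorem SolvesThirdOrder.sub {a b u u₁ u₂ v v₁ v₂ : ℝ → ℝ} (hu : SolvesThirdOrder a b u u₁ u₂)
    (hv : SolvesThirdOrder a b v v₁ v₂) :
    SolvesThirdOrder a b (fun x => u x - v x) (fun x => u₁ x - v₁ x) (fun x => u₂ x - v₂ x) where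
  deriv₀ x := (hu.deriv₀ x).sub (hv.deriv₀ x)
  deriv₁ x := (hu.deriv₁ x).sub (hv.deriv₁ x)
  deriv₂ x := ((hu.deriv₂ x).sub (hv.deriv₂ x)).congr_deriv (by ring)

/-- The Wronskian of three solutions is constant. -/
theorem SolvesThirdOrder.wronskian_eq {a b u u₁ u₂ v v₁ v₂ w w₁ w₂ : ℝ → ℝ}
    (hu : SolvesThirdOrder a b u u₁ u₂) (hv : SolvesThirdOrder a b v v₁ v₂)
    (hw : SolvesThirdOrder a b w w₁ w₂) (x y : ℝ) :
    u x * (v₁ x * w₂ x - v₂ x * w₁ x) - u₁ x * (v x * w₂ x - v₂ x * w x)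
        + u₂ x * (v x * w₁ x - v₁ x * w x) =
      u y * (v₁ y * w₂ y - v₂ y * w₁ y) - u₁ y * (v y * w₂ y - v₂ y * w y)
        + u₂ y * (v y * w₁ y - v₁ y * w y) := by
  -- Abel's identity: the equation has no u'' term, so the Wronskian has derivative zero.
  have key : ∀ t, HasDerivAt (fun x => u x * (v₁ x * w₂ x - v₂ x * w₁ x)
      - u₁ x * (v x * w₂ x - v₂ x * w x) + u₂ x * (v x * w₁ x - v₁ x * w x)) 0 t := by
    intro t
    have h := (((hu.deriv₀ t).mul (((hv.deriv₁ t).mul (hw.deriv₂ t)).sub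
      ((hv.deriv₂ t).mul (hw.deriv₁ t)))).sub ((hu.deriv₁ t).mul
      (((hv.deriv₀ t).mul (hw.deriv₂ t)).sub ((hv.deriv₂ t).mul (hw.deriv₀ t))))).add
      ((hu.deriv₂ t).mul (((hv.deriv₀ t).mul (hw.deriv₁ t)).sub
      ((hv.deriv₁ t).mul (hw.deriv₀ t))))
    refine h.congr_deriv ?_
    simp only [Pi.mul_apply, Pi.sub_apply]
    ring
  exact is_const_of_deriv_eq_zero (fun t => (key t).differentiableAt) (fun t => (key t).deriv) x y

/-- If three solutions have Wronskian `1`, then a solution with zero initial values vanishes. -/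
theorem SolvesThirdOrder.eq_zero {a b u u₁ u₂ v v₁ v₂ w w₁ w₂ z z₁ z₂ : ℝ → ℝ}
    (hu : SolvesThirdOrder a b u u₁ u₂) (hv : SolvesThirdOrder a b v v₁ v₂)
    (hw : SolvesThirdOrder a b w w₁ w₂) (hz : SolvesThirdOrder a b z z₁ z₂)
    (h1 : ∀ x, u x * (v₁ x * w₂ x - v₂ x * w₁ x) - u₁ x * (v x * w₂ x - v₂ x * w x)
        + u₂ x * (v x * w₁ x - v₁ x * w x) = 1)
    {y : ℝ} (z0 : z y = 0) (z1 : z₁ y = 0) (z2 : z₂ y = 0) (x : ℝ) : z x = 0 := by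
  have e1 := hz.wronskian_eq hv hw x y
  have e2 := hz.wronskian_eq hu hw x y
  have e3 := hz.wronskian_eq hu hv x y
  rw [z0, z1, z2] at e1 e2 e3
  -- Cramer's rule: z W(u,v,w) = u W(z,v,w) - v W(z,u,w) + w W(z,u,v), and the three Wronskians
  -- containing z vanish at y, hence everywhere.
  linear_combination (-z x) * h1 x + u x * e1 - v x * e2 + w x * e3

/-! ### Minors of the matrix of partial derivatives -/

/-- The `3 × 3` minor of the matrix of partial derivatives with rows `i`, `j`, `k` and
columns `0`, `1`, `2`. -/
noncomputable def minor (F : ℝ → ℝ → ℝ) (i j k : ℕ) : ℝ → ℝ → ℝ := fun x y =>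
  partials F i 0 x y * (partials F j 1 x y * partials F k 2 x y
      - partials F j 2 x y * partials F k 1 x y)
    - partials F i 1 x y * (partials F j 0 x y * partials F k 2 x y
      - partials F j 2 x y * partials F k 0 x y)
    + partials F i 2 x y * (partials F j 0 x y * partials F k 1 x y
      - partials F j 1 x y * partials F k 0 x y)

theorem Smooth₂.minor {F : ℝ → ℝ → ℝ} (h : Smooth₂ F) (i j k : ℕ) : Smooth₂ (minor F i j k) := by
  have hp : ∀ i j, ContDiff ℝ ∞ (fun p : ℝ × ℝ => TwoFrieze.partials F i j p.1 p.2) := h.partials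
  unfold Smooth₂ TwoFrieze.minor
  exact ((((hp i 0).mul (((hp j 1).mul (hp k 2)).sub ((hp j 2).mul (hp k 1)))).sub
    ((hp i 1).mul (((hp j 0).mul (hp k 2)).sub ((hp j 2).mul (hp k 0))))).add
    ((hp i 2).mul (((hp j 0).mul (hp k 1)).sub ((hp j 1).mul (hp k 0)))))

theorem Smooth₂.hasDerivAt_minor {F : ℝ → ℝ → ℝ} (h : Smooth₂ F) (i j k : ℕ) (x y : ℝ) :
    HasDerivAt (fun t => TwoFrieze.minor F i j k t y) (TwoFrieze.minor F (i + 1) j k x y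
      + TwoFrieze.minor F i (j + 1) k x y + TwoFrieze.minor F i j (k + 1) x y) x := by
  have hp : ∀ i j, HasDerivAt (fun t => TwoFrieze.partials F i j t y)
    (TwoFrieze.partials F (i + 1) j x y) x := fun i j => h.hasDerivAt_partials_left i j x y
  refine ((((hp i 0).mul (((hp j 1).mul (hp k 2)).sub ((hp j 2).mul (hp k 1)))).sub
    ((hp i 1).mul (((hp j 0).mul (hp k 2)).sub ((hp j 2).mul (hp k 0))))).add
    ((hp i 2).mul (((hp j 0).mul (hp k 1)).sub ((hp j 1).mul (hp k 0))))).congr_deriv ?_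
  simp only [Pi.mul_apply, Pi.sub_apply, TwoFrieze.minor]
  ring

/-! ### The rank of the matrix of partial derivatives of a frieze -/

section frieze

variable {F G : ℝ → ℝ → ℝ}

theorem IsTwoFrieze.right_eq_partials (h : IsTwoFrieze F G) (x y : ℝ) :
    G x y = partials F 0 0 x y * partials F 1 1 x y - partials F 1 0 x y * partials F 0 1 x y := by
  rw [h.right_eq, ← h.smooth_left.dy_partials 1 0]
  rfl

theorem IsTwoFrieze.dx_right (h : IsTwoFrieze F G) (x y : ℝ) : dx G x y =
    partials F 0 0 x y * partials F 2 1 x y - partials F 2 0 x y * partials F 0 1 x y := by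
  have hp := fun i j => h.smooth_left.hasDerivAt_partials_left i j x y
  have e := ((hp 0 0).mul (hp 1 1)).sub ((hp 1 0).mul (hp 0 1))
  have hG := h.smooth_right.hasDerivAt_left x y
  have hfun : (fun t => G t y) = fun t => partials F 0 0 t y * partials F 1 1 t y
      - partials F 1 0 t y * partials F 0 1 t y := funext fun t => h.right_eq_partials t y
  rw [hfun] at hG
  rw [hG.unique e]
  ring

theorem IsTwoFrieze.dy_right (h : IsTwoFrieze F G) (x y : ℝ) : dy G x y =
    partials F 0 0 x y * partials F 1 2 x y - partials F 1 0 x y * partials F 0 2 x y := by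
  have hp := fun i j => h.smooth_left.hasDerivAt_partials_right i j x y
  have e := ((hp 0 0).mul (hp 1 1)).sub ((hp 1 0).mul (hp 0 1))
  have hG := h.smooth_right.hasDerivAt_right x y
  have hfun : (fun t => G x t) = fun t => partials F 0 0 x t * partials F 1 1 x t
      - partials F 1 0 x t * partials F 0 1 x t := funext fun t => h.right_eq_partials x t
  rw [hfun] at hG
  rw [hG.unique e]
  ring

theorem IsTwoFrieze.dy_dx_right (h : IsTwoFrieze F G) (x y : ℝ) : dy (dx G) x y =
    partials F 0 1 x y * partials F 2 1 x y + partials F 0 0 x y * partials F 2 2 x y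
      - partials F 2 1 x y * partials F 0 1 x y - partials F 2 0 x y * partials F 0 2 x y := by
  have hp := fun i j => h.smooth_left.hasDerivAt_partials_right i j x y
  have e := ((hp 0 0).mul (hp 2 1)).sub ((hp 2 0).mul (hp 0 1))
  have hG := h.smooth_right.dx.hasDerivAt_right x y
  have hfun : (fun t => dx G x t) = fun t => partials F 0 0 x t * partials F 2 1 x t
      - partials F 2 0 x t * partials F 0 1 x t := funext fun t => h.dx_right x t
  rw [hfun] at hG
  rw [hG.unique e]
  ring

/-- The Desnanot–Jacobi identity for the `3 × 3` matrix of partial derivatives. -/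
theorem IsTwoFrieze.mul_minor (h : IsTwoFrieze F G) (x y : ℝ) :
    F x y * minor F 0 1 2 x y = F x y := by
  have e := h.left_eq x y
  -- G, G_x, G_y and G_xy are the four 2 × 2 minors through the corner entry F, with rows and
  -- columns {0,1} or {0,2}.
  rw [h.dy_dx_right, h.dx_right, h.dy_right, h.right_eq_partials] at e
  have hF : partials F 0 0 x y = F x y := rfl
  rw [hF] at e
  rw [minor, hF]
  linear_combination -e

theorem minor_eq_zero_of_eventually (p : ℝ × ℝ) (hp : ∀ᶠ q in 𝓝 p, F q.1 q.2 = 0) :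
    minor F 0 1 2 p.1 p.2 = 0 := by
  have h0 := fun i j => (eventually_partials_eq_zero hp i j).self_of_nhds
  simp [minor, h0]

theorem IsTwoFrieze.minor_eq_one (h : IsTwoFrieze F G)
    (hd : ∃ x, minor F 0 1 2 x x = 1) (x y : ℝ) : minor F 0 1 2 x y = 1 := by
  have hc : Continuous (fun p : ℝ × ℝ => minor F 0 1 2 p.1 p.2) :=
    (h.smooth_left.minor 0 1 2).continuous
  have h01 : ∀ p : ℝ × ℝ, minor F 0 1 2 p.1 p.2 = 1 ∨ minor F 0 1 2 p.1 p.2 = 0 := by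
    intro p
    by_cases h1 : minor F 0 1 2 p.1 p.2 = 1
    · exact Or.inl h1
    · refine Or.inr (minor_eq_zero_of_eventually p ?_)
      filter_upwards [hc.continuousAt.eventually_ne h1] with q hq
      have := h.mul_minor q.1 q.2
      by_contra hF
      exact hq (mul_left_cancel₀ hF (this.trans (mul_one _).symm))
  obtain ⟨t, ht⟩ := hd
  by_contra hne
  have h0 := (h01 (x, y)).resolve_left hne
  obtain ⟨p, hp⟩ := mem_range_of_exists_le_of_exists_ge hc
    (c := 1 / 2) ⟨(x, y), by rw [h0]; norm_num⟩ ⟨(t, t), by rw [ht]; norm_num⟩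
  rcases h01 p with h1 | h1 <;> have h2 := h1.symm.trans hp <;> norm_num at h2

theorem IsTwoFrieze.not_eventually_right_eq_zero (h : IsTwoFrieze F G)
    (h1 : ∀ x y, minor F 0 1 2 x y = 1) (p : ℝ × ℝ) : ¬ ∀ᶠ q in 𝓝 p, G q.1 q.2 = 0 := by
  intro hG
  have hF : ∀ᶠ q in 𝓝 p, F q.1 q.2 = 0 := by
    filter_upwards [hG, eventually_dx_eq_zero hG] with q hq hq1
    rw [h.left_eq, hq, hq1]
    ring
  exact one_ne_zero ((h1 p.1 p.2).symm.trans (minor_eq_zero_of_eventually p hF))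

/-- The set where G ≠ 0 is dense, so a continuous function may be cancelled against G. -/
theorem IsTwoFrieze.eq_zero_of_mul_right (h : IsTwoFrieze F G)
    (h1 : ∀ x y, minor F 0 1 2 x y = 1) {f : ℝ → ℝ → ℝ} (hf : Smooth₂ f)
    (h0 : ∀ x y, f x y * G x y = 0) (x y : ℝ) : f x y = 0 := by
  by_contra hne
  have hc : Continuous (fun p : ℝ × ℝ => f p.1 p.2) := hf.continuous
  refine h.not_eventually_right_eq_zero h1 (x, y) ?_
  filter_upwards [hc.continuousAt.eventually_ne (x := (x, y)) hne] with q hq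
  exact (mul_eq_zero.mp (h0 q.1 q.2)).resolve_left hq

/-- In the x-derivative of the constant minor, only the term that raises the last row has no
repeated row. -/
theorem IsTwoFrieze.minor_zero_one_three (h : IsTwoFrieze F G)
    (h1 : ∀ x y, minor F 0 1 2 x y = 1) (x y : ℝ) : minor F 0 1 3 x y = 0 := by
  have e := h.smooth_left.hasDerivAt_minor 0 1 2 x y
  have hfun : (fun t => minor F 0 1 2 t y) = fun _ => 1 := funext fun t => h1 t y
  rw [hfun] at e
  have e2 := e.unique (hasDerivAt_const x (1 : ℝ))
  simp only [minor] at e2 ⊢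
  linear_combination e2

/-- Cramer's rule expresses row 3 through rows 0, 1, 2; the coefficient of row 2 is the vanishing
minor 0, 1, 3. -/
theorem IsTwoFrieze.partials_three (h : IsTwoFrieze F G)
    (h1 : ∀ x y, minor F 0 1 2 x y = 1) {j : ℕ} (hj : j < 3) (x y : ℝ) :
    partials F 3 j x y =
      minor F 3 1 2 x y * partials F 0 j x y + minor F 0 3 2 x y * partials F 1 j x y := by
  have e1 := h1 x y
  have e0 := h.minor_zero_one_three h1 x y
  simp only [minor] at e0 e1 ⊢
  interval_cases j
  · linear_combination (-partials F 3 0 x y) * e1 + partials F 2 0 x y * e0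
  · linear_combination (-partials F 3 1 x y) * e1 + partials F 2 1 x y * e0
  · linear_combination (-partials F 3 2 x y) * e1 + partials F 2 2 x y * e0

/-- Differentiating the relation for column j in y and subtracting the one for column j + 1 leaves a
relation between rows 0 and 1 with the differentiated coefficients. It holds in columns 0 and 1,
whose determinant is G. -/
theorem IsTwoFrieze.dy_minors (h : IsTwoFrieze F G)
    (h1 : ∀ x y, minor F 0 1 2 x y = 1) (x y : ℝ) :
    dy (minor F 3 1 2) x y = 0 ∧ dy (minor F 0 3 2) x y = 0 := by
  have hs := h.smooth_left
  have key : ∀ j < 2, ∀ x y, dy (minor F 3 1 2) x y * partials F 0 j x y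
      + dy (minor F 0 3 2) x y * partials F 1 j x y = 0 := by
    intro j hj x y
    have e1 := hs.hasDerivAt_partials_right 3 j x y
    have e2 := ((((hs.minor 3 1 2).hasDerivAt_right x y).mul
      (hs.hasDerivAt_partials_right 0 j x y)).add
      (((hs.minor 0 3 2).hasDerivAt_right x y).mul (hs.hasDerivAt_partials_right 1 j x y)))
    have hfun : (fun t => partials F 3 j x t) = fun t => minor F 3 1 2 x t * partials F 0 j x t
        + minor F 0 3 2 x t * partials F 1 j x t :=
      funext fun t => h.partials_three h1 (by omega) x t
    rw [hfun] at e1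
    have e3 := e1.unique e2
    have e4 := h.partials_three h1 (j := j + 1) (by omega) x y
    linear_combination e4 - e3
  constructor
  · refine h.eq_zero_of_mul_right h1 (hs.minor 3 1 2).dy (fun x y => ?_) x y
    rw [h.right_eq_partials]
    linear_combination partials F 1 1 x y * key 0 (by omega) x y
      - partials F 1 0 x y * key 1 (by omega) x y
  · refine h.eq_zero_of_mul_right h1 (hs.minor 0 3 2).dy (fun x y => ?_) x y
    rw [h.right_eq_partials]
    linear_combination partials F 0 0 x y * key 1 (by omega) x y
      - partials F 0 1 x y * key 0 (by omega) x y

/-- All the functions `∂ⱼ F(·, y)` with `j < 3` solve one and the same differential equation. -/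
theorem IsTwoFrieze.solvesThirdOrder (h : IsTwoFrieze F G)
    (h1 : ∀ x y, minor F 0 1 2 x y = 1) {j : ℕ} (hj : j < 3) (y : ℝ) :
    SolvesThirdOrder (fun x => minor F 3 1 2 x 0) (fun x => minor F 0 3 2 x 0)
      (fun x => partials F 0 j x y) (fun x => partials F 1 j x y)
      (fun x => partials F 2 j x y) := by
  have hs := h.smooth_left
  refine ⟨fun x => hs.hasDerivAt_partials_left 0 j x y,
    fun x => hs.hasDerivAt_partials_left 1 j x y, fun x => ?_⟩
  have c : ∀ {f : ℝ → ℝ → ℝ}, Smooth₂ f → (∀ x y, dy f x y = 0) → f x 0 = f x y := by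
    intro f hf h0
    exact is_const_of_deriv_eq_zero (f := fun t => f x t)
      (fun t => (hf.hasDerivAt_right x t).differentiableAt) (fun t => h0 x t) 0 y
  refine (hs.hasDerivAt_partials_left 2 j x y).congr_deriv ?_
  rw [h.partials_three h1 hj, c (hs.minor 3 1 2) fun x y => (h.dy_minors h1 x y).1,
    c (hs.minor 0 3 2) fun x y => (h.dy_minors h1 x y).2]

end frieze

/-! ### The curve of a frieze -/

/-- The curve with the homogeneous coordinates `F(x, 0)`, `F_y(x, 0)`, `F_yy(x, 0)`. -/
noncomputable def friezeCurve (F : ℝ → ℝ → ℝ) (x : ℝ) : Fin 3 → ℝ :=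
  ![partials F 0 0 x 0, partials F 0 1 x 0, partials F 0 2 x 0]

theorem deriv_partials_vec {F : ℝ → ℝ → ℝ} (hs : Smooth₂ F) (i : ℕ) :
    deriv (fun x => ![partials F i 0 x 0, partials F i 1 x 0, partials F i 2 x 0]) =
      fun x => ![partials F (i + 1) 0 x 0, partials F (i + 1) 1 x 0, partials F (i + 1) 2 x 0] := by
  funext x
  refine HasDerivAt.deriv (hasDerivAt_pi.2 fun k => ?_)
  fin_cases k
  · exact hs.hasDerivAt_partials_left i 0 x 0
  · exact hs.hasDerivAt_partials_left i 1 x 0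
  · exact hs.hasDerivAt_partials_left i 2 x 0

theorem deriv_friezeCurve {F : ℝ → ℝ → ℝ} (hs : Smooth₂ F) : deriv (friezeCurve F) =
    fun x => ![partials F 1 0 x 0, partials F 1 1 x 0, partials F 1 2 x 0] :=
  deriv_partials_vec hs 0

theorem wronskian_friezeCurve {F : ℝ → ℝ → ℝ} (hs : Smooth₂ F) (x : ℝ) :
    wronskian (friezeCurve F) x = minor F 0 1 2 x 0 := by
  rw [wronskian, deriv_friezeCurve hs, deriv_partials_vec hs 1, Matrix.det_fin_three]
  simp [friezeCurve, minor]
  ring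

theorem contDiff_friezeCurve {F : ℝ → ℝ → ℝ} (hs : Smooth₂ F) :
    ContDiff ℝ ∞ (friezeCurve F) := by
  have h : ∀ j, ContDiff ℝ ∞ (fun x => partials F 0 j x 0) := fun j =>
    ContDiff.comp (g := fun p : ℝ × ℝ => partials F 0 j p.1 p.2) (hs.partials 0 j)
      (contDiff_id.prodMk contDiff_const)
  refine contDiff_pi.2 fun k => ?_
  fin_cases k
  · exact h 0
  · exact h 1
  · exact h 2

theorem ne_zero_of_wronskian_ne_zero {c : ℝ → Fin 3 → ℝ} {x : ℝ} (h : wronskian c x ≠ 0) :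
    c x ≠ 0 := by
  intro h0
  apply h
  rw [wronskian, h0]
  simp [Matrix.det_fin_three]

theorem partials_add_period {F : ℝ → ℝ → ℝ} {T : ℝ} (hT : ∀ x y, F (x + T) y = F x y) (j : ℕ)
    (x y : ℝ) : partials F 0 j (x + T) y = partials F 0 j x y := by
  change (dy^[j] F) (x + T) y = (dy^[j] F) x y
  induction j generalizing x y with
  | zero => exact hT x y
  | succ j ih =>
    rw [Function.iterate_succ_apply']
    unfold dy
    exact congrArg (fun f => deriv f y) (funext fun t => ih x t)

theorem IsClosedTwoFrieze.minor_eq_one {T : ℝ} {F G : ℝ → ℝ → ℝ}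
    (h : IsClosedTwoFrieze T F G) (x y : ℝ) : minor F 0 1 2 x y = 1 := by
  refine h.frieze.minor_eq_one ⟨0, ?_⟩ x y
  have b := h.boundary_left
  have e00 : partials F 0 0 0 0 = 0 := b.diag 0
  have e10 : partials F 1 0 0 0 = 0 := b.diag_x 0
  have e01 : partials F 0 1 0 0 = 0 := b.diag_y 0
  have e20 : partials F 2 0 0 0 = 1 := b.diag_xx 0
  have e02 : partials F 0 2 0 0 = 1 := b.diag_yy 0
  have e11 : partials F 1 1 0 0 = -1 := by
    rw [← b.diag_xy 0, ← h.frieze.smooth_left.dy_partials 1 0]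
    rfl
  -- On the diagonal the matrix is antitriangular with antidiagonal 1, -1, 1, so the other
  -- second-row and third-row entries do not matter.
  simp [minor, e00, e10, e01, e20, e02, e11]

/-- As functions of x both sides solve the same third-order equation, with initial values 0, 0, 1 at
x = y. -/
theorem IsClosedTwoFrieze.eq_dotProduct {T : ℝ} {F G : ℝ → ℝ → ℝ}
    (h : IsClosedTwoFrieze T F G) (x y : ℝ) :
    F x y = friezeCurve F x ⬝ᵥ dualLift (friezeCurve F) y := by
  have h1 := h.minor_eq_one
  have hs := h.frieze.smooth_left
  have b := h.boundary_left
  have s := fun j hj => h.frieze.solvesThirdOrder h1 (j := j) hj 0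
  set d := dualLift (friezeCurve F) y with hd
  rw [dualLift, deriv_friezeCurve hs, cross_apply] at hd
  have d0 : d 0 = partials F 0 1 y 0 * partials F 1 2 y 0
      - partials F 0 2 y 0 * partials F 1 1 y 0 := by rw [hd]; simp [friezeCurve]
  have d1 : d 1 = partials F 0 2 y 0 * partials F 1 0 y 0
      - partials F 0 0 y 0 * partials F 1 2 y 0 := by rw [hd]; simp [friezeCurve]
  have d2 : d 2 = partials F 0 0 y 0 * partials F 1 1 y 0
      - partials F 0 1 y 0 * partials F 1 0 y 0 := by rw [hd]; simp [friezeCurve]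
  have hz := (((h.frieze.solvesThirdOrder h1 (j := 0) (by omega) y).sub
    ((s 0 (by omega)).smul (d 0))).sub ((s 1 (by omega)).smul (d 1))).sub
    ((s 2 (by omega)).smul (d 2))
  have e00 : partials F 0 0 y y = 0 := b.diag y
  have e10 : partials F 1 0 y y = 0 := b.diag_x y
  have e20 : partials F 2 0 y y = 1 := b.diag_xx y
  have e := SolvesThirdOrder.eq_zero (s 0 (by omega)) (s 1 (by omega)) (s 2 (by omega)) hz
    (fun x => by have := h1 x 0; simp only [minor] at this; linear_combination this)
    (y := y) (by rw [e00, d0, d1, d2]; ring) (by rw [e10, d0, d1, d2]; ring)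
    (by
      have := h1 y 0
      simp only [minor] at this
      rw [e20, d0, d1, d2]
      linear_combination -this) x
  have hF : partials F 0 0 x y = F x y := rfl
  rw [hF] at e
  rw [Matrix.vec3_dotProduct]
  simp only [friezeCurve, Matrix.cons_val]
  linear_combination e

theorem IsClosedTwoFrieze.exists_curve {T : ℝ} {F G : ℝ → ℝ → ℝ}
    (h : IsClosedTwoFrieze T F G) :
    ∃ γ : ℝ → RP2, IsClosedProjectiveCurve T γ ∧ Corresponds γ F := by
  have hs := h.frieze.smooth_left
  have hw : ∀ x, wronskian (friezeCurve F) x = 1 := fun x =>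
    (wronskian_friezeCurve hs x).trans (h.minor_eq_one x 0)
  have h0 : ∀ x, friezeCurve F x ≠ 0 := fun x =>
    ne_zero_of_wronskian_ne_zero (by rw [hw]; exact one_ne_zero)
  have hper : ∀ x, friezeCurve F (x + T) = friezeCurve F x := fun x => by
    simp only [friezeCurve, partials_add_period h.boundary_left.periodic_x]
  refine ⟨fun x => Projectivization.mk ℝ (friezeCurve F x) (h0 x), ⟨fun x => ?_, fun x => ?_⟩, ?_⟩
  · exact ⟨friezeCurve F, (contDiff_friezeCurve hs).contDiffAt,
      Filter.Eventually.of_forall fun t => ⟨h0 t, rfl⟩, by rw [hw]; exact one_ne_zero⟩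
  · simp only [hper]
  · exact ⟨friezeCurve F, ⟨contDiff_friezeCurve hs, fun x => ⟨h0 x, rfl⟩, hw⟩, h.eq_dotProduct⟩

/-! ### Normalized curves in three-space -/

/-- The `k`-th derivative of a curve. -/
noncomputable def iterDeriv (Γ : ℝ → Fin 3 → ℝ) (k : ℕ) : ℝ → Fin 3 → ℝ := deriv^[k] Γ

theorem hasDerivAt_iterDeriv {Γ : ℝ → Fin 3 → ℝ} (h : ContDiff ℝ ∞ Γ) (k : ℕ) (x : ℝ) (i : Fin 3) :
    HasDerivAt (fun t => iterDeriv Γ k t i) (iterDeriv Γ (k + 1) x i) x := by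
  have h1 : Differentiable ℝ (deriv^[k] Γ) := (h.iterate_deriv k).differentiable (by simp)
  have h2 := (h1 x).hasDerivAt
  rw [← Function.iterate_succ_apply' deriv k Γ] at h2
  exact hasDerivAt_pi.1 h2 i

theorem hasDerivAt_dotProduct {u v : ℝ → Fin 3 → ℝ} {u' v' : Fin 3 → ℝ} {x : ℝ}
    (hu : ∀ i, HasDerivAt (fun t => u t i) (u' i) x)
    (hv : ∀ i, HasDerivAt (fun t => v t i) (v' i) x) :
    HasDerivAt (fun t => u t ⬝ᵥ v t) (u' ⬝ᵥ v x + u x ⬝ᵥ v') x := by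
  simp only [Matrix.vec3_dotProduct]
  refine ((((hu 0).mul (hv 0)).add ((hu 1).mul (hv 1))).add ((hu 2).mul (hv 2))).congr_deriv ?_
  ring

theorem hasDerivAt_iterDeriv_dotProduct {Γ : ℝ → Fin 3 → ℝ} (h : ContDiff ℝ ∞ Γ) (k : ℕ) (x : ℝ)
    (d : Fin 3 → ℝ) :
    HasDerivAt (fun t => iterDeriv Γ k t ⬝ᵥ d) (iterDeriv Γ (k + 1) x ⬝ᵥ d) x := by
  refine (hasDerivAt_dotProduct (hasDerivAt_iterDeriv h k x)
    (fun i => hasDerivAt_const x (d i))).congr_deriv ?_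
  simp [Matrix.vec3_dotProduct]

/-- The matrix with the rows `Γ`, `Γ'`, `Γ''`. -/
noncomputable def frame (Γ : ℝ → Fin 3 → ℝ) (x : ℝ) : Matrix (Fin 3) (Fin 3) ℝ :=
  Matrix.of ![iterDeriv Γ 0 x, iterDeriv Γ 1 x, iterDeriv Γ 2 x]

theorem det_frame (Γ : ℝ → Fin 3 → ℝ) (x : ℝ) : (frame Γ x).det = wronskian Γ x := rfl

theorem wronskian_eq (Γ : ℝ → Fin 3 → ℝ) (x : ℝ) : wronskian Γ x =
    iterDeriv Γ 0 x 0 * (iterDeriv Γ 1 x 1 * iterDeriv Γ 2 x 2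
        - iterDeriv Γ 1 x 2 * iterDeriv Γ 2 x 1)
      - iterDeriv Γ 0 x 1 * (iterDeriv Γ 1 x 0 * iterDeriv Γ 2 x 2
        - iterDeriv Γ 1 x 2 * iterDeriv Γ 2 x 0)
      + iterDeriv Γ 0 x 2 * (iterDeriv Γ 1 x 0 * iterDeriv Γ 2 x 1
        - iterDeriv Γ 1 x 1 * iterDeriv Γ 2 x 0) := by
  rw [← det_frame, Matrix.det_fin_three]
  simp [frame]
  ring

theorem eq_zero_of_frame {Γ : ℝ → Fin 3 → ℝ} {x : ℝ} (h : wronskian Γ x ≠ 0) {d : Fin 3 → ℝ}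
    (h0 : iterDeriv Γ 0 x ⬝ᵥ d = 0) (h1 : iterDeriv Γ 1 x ⬝ᵥ d = 0)
    (h2 : iterDeriv Γ 2 x ⬝ᵥ d = 0) : d = 0 := by
  refine Matrix.eq_zero_of_mulVec_eq_zero (M := frame Γ x) h ?_
  funext i
  fin_cases i
  · exact h0
  · exact h1
  · exact h2

/-- A normalized curve spans the space. -/
theorem eq_zero_of_forall_dotProduct {Γ : ℝ → Fin 3 → ℝ} (h : ContDiff ℝ ∞ Γ)
    (hw : wronskian Γ 0 ≠ 0) {d : Fin 3 → ℝ} (hd : ∀ x, Γ x ⬝ᵥ d = 0) : d = 0 := by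
  have step : ∀ k, (∀ x, iterDeriv Γ k x ⬝ᵥ d = 0) → ∀ x, iterDeriv Γ (k + 1) x ⬝ᵥ d = 0 := by
    intro k hk x
    have e := hasDerivAt_iterDeriv_dotProduct h k x d
    rw [funext hk] at e
    exact e.unique (hasDerivAt_const x 0)
  have h0 : ∀ x, iterDeriv Γ 0 x ⬝ᵥ d = 0 := hd
  exact eq_zero_of_frame hw (h0 0) (step 0 h0 0) (step 1 (step 0 h0) 0)

/-- The first derivative `Γ × Γ''` of the dual curve. -/
noncomputable def dualLift₁ (Γ : ℝ → Fin 3 → ℝ) (y : ℝ) : Fin 3 → ℝ :=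
  crossProduct (iterDeriv Γ 0 y) (iterDeriv Γ 2 y)

/-- The second derivative `Γ' × Γ'' + Γ × Γ'''` of the dual curve. -/
noncomputable def dualLift₂ (Γ : ℝ → Fin 3 → ℝ) (y : ℝ) : Fin 3 → ℝ :=
  crossProduct (iterDeriv Γ 1 y) (iterDeriv Γ 2 y)
    + crossProduct (iterDeriv Γ 0 y) (iterDeriv Γ 3 y)

theorem dualLift_eq (Γ : ℝ → Fin 3 → ℝ) (y : ℝ) :
    dualLift Γ y = crossProduct (iterDeriv Γ 0 y) (iterDeriv Γ 1 y) := rfl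

theorem hasDerivAt_cross {Γ : ℝ → Fin 3 → ℝ} (h : ContDiff ℝ ∞ Γ) (k l : ℕ) (y : ℝ) (i : Fin 3) :
    HasDerivAt (fun t => crossProduct (iterDeriv Γ k t) (iterDeriv Γ l t) i)
      ((crossProduct (iterDeriv Γ (k + 1) y) (iterDeriv Γ l y)
        + crossProduct (iterDeriv Γ k y) (iterDeriv Γ (l + 1) y)) i) y := by
  have hp := fun k i => hasDerivAt_iterDeriv h k y i
  simp only [Pi.add_apply, cross_apply]
  fin_cases i
  · refine (((hp k 1).mul (hp l 2)).sub ((hp k 2).mul (hp l 1))).congr_deriv ?_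
    simp
    ring
  · refine (((hp k 2).mul (hp l 0)).sub ((hp k 0).mul (hp l 2))).congr_deriv ?_
    simp
    ring
  · refine (((hp k 0).mul (hp l 1)).sub ((hp k 1).mul (hp l 0))).congr_deriv ?_
    simp
    ring

theorem hasDerivAt_dualLift {Γ : ℝ → Fin 3 → ℝ} (h : ContDiff ℝ ∞ Γ) (y : ℝ) (i : Fin 3) :
    HasDerivAt (fun t => dualLift Γ t i) (dualLift₁ Γ y i) y := by
  refine (hasDerivAt_cross h 0 1 y i).congr_deriv ?_
  simp [dualLift₁]

theorem hasDerivAt_dualLift₁ {Γ : ℝ → Fin 3 → ℝ} (h : ContDiff ℝ ∞ Γ) (y : ℝ) (i : Fin 3) :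
    HasDerivAt (fun t => dualLift₁ Γ t i) (dualLift₂ Γ y i) y :=
  hasDerivAt_cross h 0 2 y i

/-- The second function of a frieze is the transpose of the first one. -/
theorem IsTwoFrieze.right_eq_left_swap {F G : ℝ → ℝ → ℝ} (h : IsTwoFrieze F G)
    {Γ : ℝ → Fin 3 → ℝ} (hΓ : ContDiff ℝ ∞ Γ) (hw : ∀ x, wronskian Γ x = 1)
    (hF : ∀ x y, F x y = Γ x ⬝ᵥ dualLift Γ y) (x y : ℝ) : G x y = F y x := by
  have h10 : ∀ x y, dx F x y = iterDeriv Γ 1 x ⬝ᵥ dualLift Γ y := by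
    intro x y
    have e : (fun t => F t y) = fun t => iterDeriv Γ 0 t ⬝ᵥ dualLift Γ y :=
      funext fun t => hF t y
    rw [dx, e]
    exact (hasDerivAt_iterDeriv_dotProduct hΓ 0 x _).deriv
  have hy : ∀ (v : Fin 3 → ℝ) (y : ℝ),
      HasDerivAt (fun t => v ⬝ᵥ dualLift Γ t) (v ⬝ᵥ dualLift₁ Γ y) y := by
    intro v y
    refine (hasDerivAt_dotProduct (fun i => hasDerivAt_const y (v i))
      (hasDerivAt_dualLift hΓ y)).congr_deriv ?_
    simp [Matrix.vec3_dotProduct]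
  have h01 : dy F x y = iterDeriv Γ 0 x ⬝ᵥ dualLift₁ Γ y := by
    have e : (fun t => F x t) = fun t => iterDeriv Γ 0 x ⬝ᵥ dualLift Γ t :=
      funext fun t => hF x t
    rw [dy, e]
    exact (hy _ y).deriv
  have h11 : dy (dx F) x y = iterDeriv Γ 1 x ⬝ᵥ dualLift₁ Γ y := by
    have e : (fun t => dx F x t) = fun t => iterDeriv Γ 1 x ⬝ᵥ dualLift Γ t :=
      funext fun t => h10 x t
    rw [dy, e]
    exact (hy _ y).deriv
  have h00 : ∀ x y, F x y = iterDeriv Γ 0 x ⬝ᵥ dualLift Γ y := hF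
  have e := hw y
  rw [wronskian_eq] at e
  rw [h.right_eq, h11, h10, h01, h00 x y, h00 y x]
  simp only [dualLift_eq, dualLift₁, cross_apply, Matrix.vec3_dotProduct, Matrix.cons_val]
  -- By Binet–Cauchy, F F_xy - F_x F_y = (Γ × Γ')(x) · (Γ* × Γ*')(y), and Γ* × Γ*' = det(Γ, Γ', Γ'')
  -- Γ = Γ.
  linear_combination (iterDeriv Γ 0 y 0
      * (iterDeriv Γ 0 x 1 * iterDeriv Γ 1 x 2 - iterDeriv Γ 0 x 2 * iterDeriv Γ 1 x 1)
    + iterDeriv Γ 0 y 1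
      * (iterDeriv Γ 0 x 2 * iterDeriv Γ 1 x 0 - iterDeriv Γ 0 x 0 * iterDeriv Γ 1 x 2)
    + iterDeriv Γ 0 y 2
      * (iterDeriv Γ 0 x 0 * iterDeriv Γ 1 x 1 - iterDeriv Γ 0 x 1 * iterDeriv Γ 1 x 0)) * e

/-! ### Conics -/

theorem mk_mem_conic {Q : Matrix (Fin 3) (Fin 3) ℝ} {v : Fin 3 → ℝ} (hv : v ≠ 0) :
    Projectivization.mk ℝ v hv ∈ conic Q ↔ v ⬝ᵥ (Q *ᵥ v) = 0 := by
  simp only [conic, Set.mem_ofPred_eq, Projectivization.submodule_mk]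
  constructor
  · intro h
    exact h v (Submodule.mem_span_singleton_self v)
  · intro h u hu
    obtain ⟨a, rfl⟩ := Submodule.mem_span_singleton.1 hu
    simp [Matrix.mulVec_smul, h]

theorem dotProduct_mulVec_comm {Q : Matrix (Fin 3) (Fin 3) ℝ} (hQ : Q.IsSymm) (u v : Fin 3 → ℝ) :
    u ⬝ᵥ (Q *ᵥ v) = v ⬝ᵥ (Q *ᵥ u) := by
  rw [Matrix.dotProduct_mulVec, dotProduct_comm, ← Matrix.mulVec_transpose, hQ.eq]

/-- If `Γ(x) · Γ*(y)` is symmetric, then `Γ* = Q Γ` with a nondegenerate symmetric matrix `Q`. -/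
theorem exists_polarity {Γ : ℝ → Fin 3 → ℝ} (hΓ : ContDiff ℝ ∞ Γ) (hw : ∀ x, wronskian Γ x = 1)
    (hsym : ∀ x y, Γ x ⬝ᵥ dualLift Γ y = Γ y ⬝ᵥ dualLift Γ x) :
    ∃ Q : Matrix (Fin 3) (Fin 3) ℝ, Q.IsSymm ∧ Q.det ≠ 0 ∧ ∀ y, Q *ᵥ Γ y = dualLift Γ y := by
  have hw0 : wronskian Γ 0 ≠ 0 := by rw [hw]; exact one_ne_zero
  have e0 : ∀ x y, iterDeriv Γ 0 x ⬝ᵥ dualLift Γ y = dualLift Γ x ⬝ᵥ Γ y := fun x y =>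
    (hsym x y).trans (dotProduct_comm _ _)
  have e1 : ∀ x y, iterDeriv Γ 1 x ⬝ᵥ dualLift Γ y = dualLift₁ Γ x ⬝ᵥ Γ y := by
    intro x y
    have e := hasDerivAt_iterDeriv_dotProduct hΓ 0 x (dualLift Γ y)
    rw [funext fun x => e0 x y] at e
    refine e.unique ((hasDerivAt_dotProduct (hasDerivAt_dualLift hΓ x)
      (fun i => hasDerivAt_const x (Γ y i))).congr_deriv ?_)
    simp [Matrix.vec3_dotProduct]
  have e2 : ∀ x y, iterDeriv Γ 2 x ⬝ᵥ dualLift Γ y = dualLift₂ Γ x ⬝ᵥ Γ y := by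
    intro x y
    have e := hasDerivAt_iterDeriv_dotProduct hΓ 1 x (dualLift Γ y)
    rw [funext fun x => e1 x y] at e
    refine e.unique ((hasDerivAt_dotProduct (hasDerivAt_dualLift₁ hΓ x)
      (fun i => hasDerivAt_const x (Γ y i))).congr_deriv ?_)
    simp [Matrix.vec3_dotProduct]
  set A := frame Γ 0 with hA
  set B : Matrix (Fin 3) (Fin 3) ℝ :=
    Matrix.of ![dualLift Γ 0, dualLift₁ Γ 0, dualLift₂ Γ 0] with hB
  have hAdet : A.det = 1 := hw 0
  -- The determinant of Γ*, Γ*', Γ*'' is the square of the Wronskian of Γ; the terms with Γ'''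
  -- cancel.
  have hBdet : B.det = 1 := by
    have e := hw 0
    rw [wronskian_eq] at e
    rw [Matrix.det_fin_three]
    simp only [hB, Matrix.of_apply, Matrix.cons_val, dualLift_eq, dualLift₁, dualLift₂,
      cross_apply, Pi.add_apply]
    linear_combination (iterDeriv Γ 0 0 0 * (iterDeriv Γ 1 0 1 * iterDeriv Γ 2 0 2
        - iterDeriv Γ 1 0 2 * iterDeriv Γ 2 0 1)
      - iterDeriv Γ 0 0 1 * (iterDeriv Γ 1 0 0 * iterDeriv Γ 2 0 2
        - iterDeriv Γ 1 0 2 * iterDeriv Γ 2 0 0)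
      + iterDeriv Γ 0 0 2 * (iterDeriv Γ 1 0 0 * iterDeriv Γ 2 0 1
        - iterDeriv Γ 1 0 1 * iterDeriv Γ 2 0 0) + 1) * e
  have hAB : ∀ y, A *ᵥ dualLift Γ y = B *ᵥ Γ y := by
    intro y
    funext i
    fin_cases i
    · exact e0 0 y
    · exact e1 0 y
    · exact e2 0 y
  have hAunit : IsUnit A.det := by rw [hAdet]; exact isUnit_one
  have hQ : ∀ y, (A⁻¹ * B) *ᵥ Γ y = dualLift Γ y := by
    intro y
    rw [← Matrix.mulVec_mulVec, ← hAB, Matrix.mulVec_mulVec, Matrix.nonsing_inv_mul A hAunit,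
      Matrix.one_mulVec]
  refine ⟨A⁻¹ * B, ?_, ?_, hQ⟩
  · have h1 : ∀ y, ((A⁻¹ * B) - (A⁻¹ * B)ᵀ) *ᵥ Γ y = 0 := by
      intro y
      refine eq_zero_of_forall_dotProduct hΓ hw0 fun x => ?_
      rw [Matrix.sub_mulVec, dotProduct_sub, hQ, Matrix.mulVec_transpose, dotProduct_comm (Γ x)
        (Γ y ᵥ* _), ← Matrix.dotProduct_mulVec, hQ, hsym, sub_self]
    have h2 : (A⁻¹ * B) - (A⁻¹ * B)ᵀ = 0 := by
      ext i j
      refine congrFun (eq_zero_of_forall_dotProduct hΓ hw0 fun x => ?_) j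
      rw [dotProduct_comm]
      exact congrFun (h1 x) i
    exact (sub_eq_zero.1 h2).symm
  · rw [Matrix.det_mul, Matrix.det_nonsing_inv, hAdet, hBdet]
    simp

/-- When u × v = 0, expanding u × (u × v) gives (u · u) v = (u · v) u. -/
theorem eq_smul_of_cross_eq_zero {u v : Fin 3 → ℝ} (hu : u ≠ 0) (h : crossProduct u v = 0) :
    ∃ a : ℝ, v = a • u := by
  have hd : u ⬝ᵥ u ≠ 0 := fun h0 => hu (dotProduct_self_eq_zero.1 h0)
  refine ⟨(u ⬝ᵥ v) / (u ⬝ᵥ u), ?_⟩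
  rw [cross_apply] at h
  have h0 := congrFun h 0
  have h1 := congrFun h 1
  have h2 := congrFun h 2
  simp only [Matrix.cons_val, Pi.zero_apply] at h0 h1 h2
  funext i
  rw [Pi.smul_apply, smul_eq_mul, div_mul_eq_mul_div, eq_div_iff hd]
  simp only [Matrix.vec3_dotProduct]
  fin_cases i <;> simp only [Fin.zero_eta, Fin.mk_one, Fin.reduceFinMk]
  · linear_combination u 2 * h1 - u 1 * h2
  · linear_combination u 0 * h2 - u 2 * h0
  · linear_combination u 1 * h0 - u 0 * h1

/-- A nondegenerate quadratic form in three variables has no isotropic plane. -/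
theorem exists_smul_of_isotropic {Q : Matrix (Fin 3) (Fin 3) ℝ} (hQ : Q.IsSymm) (hdet : Q.det ≠ 0)
    {u v : Fin 3 → ℝ} (hu : u ≠ 0) (huu : u ⬝ᵥ (Q *ᵥ u) = 0) (huv : u ⬝ᵥ (Q *ᵥ v) = 0)
    (hvv : v ⬝ᵥ (Q *ᵥ v) = 0) : ∃ a : ℝ, v = a • u := by
  have hvu : v ⬝ᵥ (Q *ᵥ u) = 0 := (dotProduct_mulVec_comm hQ v u).trans huv
  refine eq_smul_of_cross_eq_zero hu ?_
  by_contra hn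
  -- If u, v were independent, Qu and Qv would both be normal to their plane, hence proportional,
  -- contradicting the injectivity of Q.
  have key : ∀ q : Fin 3 → ℝ, u ⬝ᵥ q = 0 → v ⬝ᵥ q = 0 → ∃ a : ℝ, q = a • crossProduct u v := by
    intro q h1 h2
    refine eq_smul_of_cross_eq_zero hn ?_
    rw [Matrix.vec3_dotProduct] at h1 h2
    simp only [cross_apply, Matrix.cons_val]
    funext i
    fin_cases i <;> simp only [Fin.zero_eta, Fin.mk_one, Fin.reduceFinMk, Matrix.cons_val,
      Pi.zero_apply]
    · linear_combination v 0 * h1 - u 0 * h2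
    · linear_combination v 1 * h1 - u 1 * h2
    · linear_combination v 2 * h1 - u 2 * h2
  obtain ⟨a, ha⟩ := key _ huu hvu
  obtain ⟨b, hb⟩ := key _ huv hvv
  have h0 : b • u - a • v = 0 := by
    refine Matrix.eq_zero_of_mulVec_eq_zero hdet ?_
    rw [Matrix.mulVec_sub, Matrix.mulVec_smul, Matrix.mulVec_smul, ha, hb, smul_comm, sub_self]
  have h1 : a • crossProduct u v = 0 := by
    rw [← map_smul, ← sub_eq_zero.1 h0, map_smul, cross_self, smul_zero]
  rw [h1] at ha
  exact hu (Matrix.eq_zero_of_mulVec_eq_zero hdet ha)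

/-- If `Γ* = Q Γ` is periodic, then the tangent of the conic at any of its points contains a
point of the curve. -/
theorem exists_dotProduct_dualLift_eq_zero {Γ : ℝ → Fin 3 → ℝ} (hΓ : ContDiff ℝ ∞ Γ)
    (hw : ∀ x, wronskian Γ x = 1) {T : ℝ} (hT : 0 < T) (hper : dualLift Γ T = dualLift Γ 0)
    {Q : Matrix (Fin 3) (Fin 3) ℝ} (hQ : Q.IsSymm) (hQΓ : ∀ y, Q *ᵥ Γ y = dualLift Γ y)
    {w : Fin 3 → ℝ} (hw0 : w ≠ 0) (hww : w ⬝ᵥ (Q *ᵥ w) = 0) : ∃ x, w ⬝ᵥ dualLift Γ x = 0 := by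
  by_contra! hne
  set q := Q *ᵥ w with hq
  have hwq : ∀ t, w ⬝ᵥ dualLift Γ t = iterDeriv Γ 0 t ⬝ᵥ q := fun t => by
    rw [← hQΓ, dotProduct_mulVec_comm hQ]
    rfl
  have hder : ∀ (v : Fin 3 → ℝ) (y : ℝ),
      HasDerivAt (fun t => v ⬝ᵥ dualLift Γ t) (v ⬝ᵥ dualLift₁ Γ y) y := by
    intro v y
    refine (hasDerivAt_dotProduct (fun i => hasDerivAt_const y (v i))
      (hasDerivAt_dualLift hΓ y)).congr_deriv ?_
    simp [Matrix.vec3_dotProduct]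
  -- Since w · q = 0, w and z span the tangent line of the conic at w. Up to sign, z · Γ* / w · Γ*
  -- is the affine coordinate in which the tangent of the curve meets that line. It takes equal
  -- values at 0 and T, so Rolle applies.
  set z := crossProduct w q with hz
  have hs := fun t => (hder z t).div (hder w t) (hne t)
  obtain ⟨c, -, hc⟩ := exists_hasDerivAt_eq_zero hT
    (fun t _ => (hs t).continuousAt.continuousWithinAt) (by simp only [Pi.div_apply, hper])
    (fun t _ => hs t)
  -- The numerator is -(z × w) · Γ, because Γ* × Γ*' = Γ; moreover z × w = (w · w) q and q · Γ = w ·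
  -- Γ*.
  have hnum : (z ⬝ᵥ dualLift₁ Γ c) * (w ⬝ᵥ dualLift Γ c) - (z ⬝ᵥ dualLift Γ c) *
      (w ⬝ᵥ dualLift₁ Γ c) = -((w ⬝ᵥ w) * (w ⬝ᵥ dualLift Γ c)) := by
    have e1 := hw c
    have e2 := hww
    have e3 := hwq c
    rw [wronskian_eq] at e1
    simp only [hz, dualLift_eq, dualLift₁, cross_apply, Matrix.vec3_dotProduct,
      Matrix.cons_val] at e2 e3 ⊢
    linear_combination (-((w 0 * w 0 + w 1 * w 1 + w 2 * w 2) * (iterDeriv Γ 0 c 0 * q 0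
        + iterDeriv Γ 0 c 1 * q 1 + iterDeriv Γ 0 c 2 * q 2))) * e1
      + (iterDeriv Γ 0 c 0 * (iterDeriv Γ 1 c 1 * iterDeriv Γ 2 c 2
        - iterDeriv Γ 1 c 2 * iterDeriv Γ 2 c 1)
      - iterDeriv Γ 0 c 1 * (iterDeriv Γ 1 c 0 * iterDeriv Γ 2 c 2
        - iterDeriv Γ 1 c 2 * iterDeriv Γ 2 c 0)
      + iterDeriv Γ 0 c 2 * (iterDeriv Γ 1 c 0 * iterDeriv Γ 2 c 1
        - iterDeriv Γ 1 c 1 * iterDeriv Γ 2 c 0)) * (w 0 * iterDeriv Γ 0 c 0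
        + w 1 * iterDeriv Γ 0 c 1 + w 2 * iterDeriv Γ 0 c 2) * e2
      + (w 0 * w 0 + w 1 * w 1 + w 2 * w 2) * e3
  have h2 : (w ⬝ᵥ w) * (w ⬝ᵥ dualLift Γ c) ≠ 0 :=
    mul_ne_zero (fun h0 => hw0 (dotProduct_self_eq_zero.1 h0)) (hne c)
  rw [hnum] at hc
  exact div_ne_zero (neg_ne_zero.2 h2) (pow_ne_zero 2 (hne c)) hc

/-- For surjectivity, a point w of the conic is conjugate to some Γ(x). Both are isotropic, so they
coincide projectively, as there is no isotropic plane. -/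
theorem range_eq_conic {Γ : ℝ → Fin 3 → ℝ} {γ : ℝ → RP2} (hγ : IsLift Γ γ) {T : ℝ} (hT : 0 < T)
    (hper : dualLift Γ T = dualLift Γ 0) {Q : Matrix (Fin 3) (Fin 3) ℝ} (hQ : Q.IsSymm)
    (hdet : Q.det ≠ 0) (hQΓ : ∀ y, Q *ᵥ Γ y = dualLift Γ y) : Set.range γ = conic Q := by
  have hiso : ∀ x, Γ x ⬝ᵥ (Q *ᵥ Γ x) = 0 := fun x => by
    rw [hQΓ]
    exact dot_self_cross _ _
  ext p
  constructor
  · rintro ⟨x, rfl⟩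
    obtain ⟨h0, h1⟩ := hγ.represents x
    rw [← h1, mk_mem_conic]
    exact hiso x
  · induction p using Projectivization.ind with
    | h w hw =>
      intro hp
      rw [mk_mem_conic] at hp
      obtain ⟨x, hx⟩ := exists_dotProduct_dualLift_eq_zero hγ.smooth hγ.normalized hT hper hQ hQΓ
        hw hp
      rw [← hQΓ] at hx
      obtain ⟨a, ha⟩ := exists_smul_of_isotropic hQ hdet hw hp hx (hiso x)
      obtain ⟨h0, h1⟩ := hγ.represents x
      exact ⟨x, by rw [← h1, Projectivization.mk_eq_mk_iff']; exact ⟨a, ha.symm⟩⟩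

/-- The pairing of a normalized curve on a nondegenerate conic with its dual is symmetric. -/
theorem dotProduct_dualLift_comm {Γ : ℝ → Fin 3 → ℝ} (hΓ : ContDiff ℝ ∞ Γ)
    (hw : ∀ x, wronskian Γ x = 1) {Q : Matrix (Fin 3) (Fin 3) ℝ} (hQ : Q.IsSymm)
    (hdet : Q.det ≠ 0) (hiso : ∀ x, Γ x ⬝ᵥ (Q *ᵥ Γ x) = 0) (x y : ℝ) :
    Γ x ⬝ᵥ dualLift Γ y = Γ y ⬝ᵥ dualLift Γ x := by
  set b : ℕ → ℕ → ℝ → ℝ := fun k l x => iterDeriv Γ k x ⬝ᵥ (Q *ᵥ iterDeriv Γ l x) with hb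
  have hb_comm : ∀ k l x, b k l x = b l k x := fun k l x => dotProduct_mulVec_comm hQ _ _
  have hder : ∀ k l x, HasDerivAt (b k l) (b (k + 1) l x + b k (l + 1) x) x := by
    intro k l x
    refine hasDerivAt_dotProduct (hasDerivAt_iterDeriv hΓ k x) fun i => ?_
    change HasDerivAt (fun t => Q i ⬝ᵥ iterDeriv Γ l t) (Q i ⬝ᵥ iterDeriv Γ (l + 1) x) x
    simp only [dotProduct_comm (Q i)]
    exact hasDerivAt_iterDeriv_dotProduct hΓ l x (Q i)
  have h00 : ∀ x, b 0 0 x = 0 := hiso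
  have h10 : ∀ x, b 1 0 x = 0 := by
    intro x
    have e := hder 0 0 x
    rw [funext h00] at e
    have e2 := e.unique (hasDerivAt_const x 0)
    rw [hb_comm 0 (0 + 1)] at e2
    simpa using e2
  have h11 : ∀ x, b 1 1 x = -b 2 0 x := by
    intro x
    have e := hder 1 0 x
    rw [funext h10] at e
    have e2 := e.unique (hasDerivAt_const x 0)
    simp only [zero_add, Nat.reduceAdd] at e2
    linarith
  -- The Gram matrix of Γ, Γ', Γ'' under Q is antitriangular with antidiagonal λ, -λ, λ for λ = `b 2
  -- 0 x`, and the frame has determinant 1.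
  have hcube : ∀ x, b 2 0 x ^ 3 = Q.det := by
    intro x
    have hA : (frame Γ x).det = 1 := hw x
    have h1 : (frame Γ x * (Q * (frame Γ x)ᵀ)).det = Q.det := by
      rw [Matrix.det_mul, Matrix.det_mul, Matrix.det_transpose, hA, one_mul, mul_one]
    have h2 : frame Γ x * (Q * (frame Γ x)ᵀ) = Matrix.of ![![b 0 0 x, b 0 1 x, b 0 2 x],
        ![b 1 0 x, b 1 1 x, b 1 2 x], ![b 2 0 x, b 2 1 x, b 2 2 x]] := by
      ext i j
      fin_cases i <;> fin_cases j <;> rfl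
    rw [h2, Matrix.det_fin_three] at h1
    simp only [Matrix.of_apply, Matrix.cons_val] at h1
    rw [hb_comm 0 1, hb_comm 0 2, h00, h10, h11] at h1
    rw [← h1]
    ring
  -- Both vectors pair with Γ, Γ', Γ'' to 0, 0, λ.
  have hdual : ∀ x, Q *ᵥ Γ x = b 2 0 x • dualLift Γ x := by
    intro x
    have e := hw x
    rw [wronskian_eq] at e
    refine sub_eq_zero.1 (eq_zero_of_frame (Γ := Γ) (x := x) (by rw [hw]; exact one_ne_zero)
      ?_ ?_ ?_)
    · rw [dotProduct_sub, dotProduct_smul, dualLift_eq, dot_self_cross, smul_zero, sub_zero]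
      exact h00 x
    · rw [dotProduct_sub, dotProduct_smul, dualLift_eq, dot_cross_self, smul_zero, sub_zero]
      exact h10 x
    · have h1 : iterDeriv Γ 2 x ⬝ᵥ dualLift Γ x = 1 := by
        rw [dualLift_eq, ← e]
        simp only [cross_apply, Matrix.vec3_dotProduct, Matrix.cons_val]
        ring
      rw [dotProduct_sub, dotProduct_smul, h1, smul_eq_mul, mul_one]
      exact sub_self _
  have hconst : ∀ x y, b 2 0 x = b 2 0 y := fun x y =>
    (Odd.strictMono_pow (by decide : Odd 3)).injective ((hcube x).trans (hcube y).symm)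
  have hne : b 2 0 x ≠ 0 := by
    intro h0
    have := hcube x
    rw [h0] at this
    exact hdet (by rw [← this]; norm_num)
  have e := dotProduct_mulVec_comm hQ (Γ x) (Γ y)
  rw [hdual, hdual, hconst y x, dotProduct_smul, dotProduct_smul] at e
  exact mul_left_cancel₀ hne e

end TwoFrieze

theorem mainTheorem7 (T : ℝ) (hT : 0 < T) (F G : ℝ → ℝ → ℝ)
    (hFG : TwoFrieze.IsClosedTwoFrieze T F G) :
    (∃ γ : ℝ → TwoFrieze.RP2,
      TwoFrieze.IsClosedProjectiveCurve T γ ∧ TwoFrieze.Corresponds γ F) ∧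
    ∀ γ : ℝ → TwoFrieze.RP2,
      TwoFrieze.IsClosedProjectiveCurve T γ → TwoFrieze.Corresponds γ F →
        ((∀ x y, F x y = G x y) ↔ TwoFrieze.IsConic γ) := by
  refine ⟨hFG.exists_curve, ?_⟩
  rintro γ - ⟨Γ, hΓ, hF⟩
  have hG := hFG.frieze.right_eq_left_swap hΓ.smooth hΓ.normalized hF
  constructor
  · intro h
    have hsym : ∀ x y, Γ x ⬝ᵥ TwoFrieze.dualLift Γ y = Γ y ⬝ᵥ TwoFrieze.dualLift Γ x := fun x y => by
      rw [← hF, ← hF, h, hG]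
    obtain ⟨Q, hQ, hdet, hQΓ⟩ := TwoFrieze.exists_polarity hΓ.smooth hΓ.normalized hsym
    -- F(x, ·) is periodic for every x and the vectors Γ(x) span, so Γ* itself, not only its
    -- projective class, returns after T.
    have hper : TwoFrieze.dualLift Γ T = TwoFrieze.dualLift Γ 0 := by
      refine sub_eq_zero.1 (TwoFrieze.eq_zero_of_forall_dotProduct hΓ.smooth
        (by rw [hΓ.normalized]; exact one_ne_zero) fun x => ?_)
      have := hFG.boundary_left.periodic_y x 0
      rw [dotProduct_sub, ← hF, ← hF, ← this, zero_add, sub_self]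
    exact ⟨Q, hQ, hdet, TwoFrieze.range_eq_conic hΓ hT hper hQ hdet hQΓ⟩
  · rintro ⟨Q, hQ, hdet, hrange⟩ x y
    have hiso : ∀ x, Γ x ⬝ᵥ (Q *ᵥ Γ x) = 0 := by
      intro x
      obtain ⟨h0, h1⟩ := hΓ.represents x
      have hx : γ x ∈ TwoFrieze.conic Q := hrange ▸ Set.mem_range_self x
      rwa [← h1, TwoFrieze.mk_mem_conic] at hx
    rw [hG, hF, hF]
    exact TwoFrieze.dotProduct_dualLift_comm hΓ.smooth hΓ.normalized hQ hdet hiso x y
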